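/- For a topological space $Y$ let $w(Y)$ denote its weight, that is, the least cardinality of a base of the topology of $Y$. Let $\mathbb{T}=\mathbb{R}/\mathbb{Z}$ be the circle group with its usual topology, and for a topological abelian group $G$ let $\widehat{G}$ be the group of all continuous homomorphisms $\chi\colon G\to\mathbb{T}$ (continuous characters). Theorem. Let $G$ be an infinite compact Hausdorff abelian group, and let $X$ be a closed subset of $G$ (with the subspace topology) such that $w(X)<w(G)$. Then for every open neighbourhood $U$ of $0$ in $\mathbb{T}$, the set $$W(X,U)=\{\chi\in\widehat{G} : \chi(X)\subseteq U\}$$ has the same cardinality as $\widehat{G}$, i.e. $|W(X,U)|=|\widehat{G}|$. -/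

import Mathlib

universe u

/-- The weight of a topological space: the least cardinality of a base of its topology. -/
noncomputable def topWeight (Y : Type u) [TopologicalSpace Y] : Cardinal.{u} :=
  sInf {c : Cardinal.{u} | ∃ B : Set (Set Y),
    TopologicalSpace.IsTopologicalBasis B ∧ Cardinal.mk B = c}

/-- The circle group `ℝ / ℤ`, written additively. -/
abbrev CircleGroup : Type := UnitAddCircle

/-- The dual of an (additively written) topological abelian group: the group of all continuous
characters `G → ℝ / ℤ`. Mathlib equips it with the compact-open topology. -/
abbrev DualGroup (G : Type u) [AddCommGroup G] [TopologicalSpace G] : Type u :=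
  G →ₜ+ CircleGroup

/-- `W(X, U)`: the set of all continuous characters of `G` that map `X` into `U`. -/
def charSet {G : Type u} [AddCommGroup G] [TopologicalSpace G]
    (X : Set G) (U : Set CircleGroup) : Set (DualGroup G) :=
  {χ | (fun x => χ x) '' X ⊆ U}

/-! Cover the circle by finitely many open sets `D c` with `D c - D c ⊆ U`, and fix a base of `X` of
size `w(X)`. By compactness each character χ has a finite record: basic sets covering `X`, each
paired with some `D c` containing its image. Characters with equal records differ by an element of
`W(X, U)`. There are fewer records than characters, so a small `W(X, U)` would make the dual too
small (`mk_eq_of_fibers_sub_mem`). The count needs the dual to be infinite and `w(G) ≤ |Ĝ|`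
(`topWeight_le_mk_dualGroup`). Both follow once characters separate points, which is proved by
Gelfand theory applied to the regular representation on `L²`. -/

open MeasureTheory WeakDual Cardinal

/-! ### Unitary representations and their integrated operators -/

/-- A strongly continuous unitary representation of an additive group on a Hilbert space. -/
structure UnitaryRep (G H : Type*) [AddGroup G] [TopologicalSpace G]
    [NormedAddCommGroup H] [InnerProductSpace ℂ H] where
  toFun : G → H →L[ℂ] H
  map_zero : toFun 0 = 1
  map_add : ∀ x y, toFun (x + y) = toFun x * toFun y
  norm_map : ∀ x v, ‖toFun x v‖ = ‖v‖
  continuous_apply : ∀ v, Continuous fun x => toFun x v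

namespace UnitaryRep

variable {G H : Type*} [AddCommGroup G] [TopologicalSpace G]
  [NormedAddCommGroup H] [InnerProductSpace ℂ H]

theorem mul_neg_self (U : UnitaryRep G H) (x : G) : U.toFun x * U.toFun (-x) = 1 := by
  rw [← U.map_add, add_neg_cancel, U.map_zero]

theorem commute (U : UnitaryRep G H) (x y : G) : Commute (U.toFun x) (U.toFun y) := by
  rw [Commute, SemiconjBy, ← U.map_add, ← U.map_add, add_comm]

theorem star_eq [CompleteSpace H] (U : UnitaryRep G H) (x : G) :
    star (U.toFun x) = U.toFun (-x) := by
  have h : star (U.toFun x) * U.toFun x = 1 :=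
    (ContinuousLinearMap.norm_map_iff_adjoint_comp_self (U.toFun x)).1 (U.norm_map x)
  calc star (U.toFun x) = star (U.toFun x) * (U.toFun x * U.toFun (-x)) := by
        rw [mul_neg_self, mul_one]
    _ = U.toFun (-x) := by rw [← mul_assoc, h, one_mul]

/-- The translate `x ↦ f (x - g)` of a continuous function. -/
noncomputable def translate [IsTopologicalAddGroup G] (f : C(G, ℂ)) (g : G) : C(G, ℂ) := f.comp ⟨fun x => x - g, by fun_prop⟩

theorem continuous_translate [IsTopologicalAddGroup G] (f : C(G, ℂ)) : Continuous (translate f) :=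
  (ContinuousMap.curry ⟨fun p : G × G => f (p.2 - p.1), by fun_prop⟩).continuous

variable [CompactSpace G] [MeasurableSpace G] [BorelSpace G] (μ : Measure G)

theorem integrable_smul [IsFiniteMeasureOnCompacts μ] (U : UnitaryRep G H) (f : C(G, ℂ)) (v : H) :
    Integrable (fun x => f x • U.toFun x v) μ :=
  (f.continuous.smul (U.continuous_apply v)).integrable_of_hasCompactSupport
    (HasCompactSupport.of_compactSpace _)

/-- The operator `v ↦ ∫ f(x) U(x) v dμ(x)`. -/
noncomputable def integralOp [IsFiniteMeasureOnCompacts μ] (U : UnitaryRep G H) (f : C(G, ℂ)) :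
    H →L[ℂ] H :=
  LinearMap.mkContinuous
    { toFun := fun v => ∫ x, f x • U.toFun x v ∂μ
      map_add' := fun v w => by
        simp only [_root_.map_add, smul_add]
        exact integral_add (U.integrable_smul μ f v) (U.integrable_smul μ f w)
      map_smul' := fun c v => by
        simp only [map_smul, RingHom.id_apply, smul_comm _ c]
        exact integral_smul c _ }
    (‖f‖ * μ.real Set.univ) fun v => by
      have := norm_integral_le_of_norm_le_const (μ := μ) (f := fun x => f x • U.toFun x v)
        (C := ‖f‖ * ‖v‖) (Filter.Eventually.of_forall fun x => by
          rw [norm_smul, U.norm_map]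
          gcongr
          exact f.norm_coe_le_norm x)
      calc _ ≤ _ := this
        _ = _ := by ring

variable [IsFiniteMeasureOnCompacts μ] (U : UnitaryRep G H)

theorem integralOp_apply (f : C(G, ℂ)) (v : H) :
    U.integralOp μ f v = ∫ x, f x • U.toFun x v ∂μ := rfl

theorem norm_integralOp_le (f : C(G, ℂ)) : ‖U.integralOp μ f‖ ≤ ‖f‖ * μ.real Set.univ :=
  LinearMap.mkContinuous_norm_le _ (by positivity) _

theorem integralOp_sub (f g : C(G, ℂ)) :
    U.integralOp μ (f - g) = U.integralOp μ f - U.integralOp μ g := by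
  ext v
  simp only [integralOp_apply, _root_.sub_apply, ContinuousMap.sub_apply, sub_smul]
  exact integral_sub (U.integrable_smul μ f v) (U.integrable_smul μ g v)

theorem continuous_integralOp : Continuous (U.integralOp μ) := by
  refine (LipschitzWith.of_dist_le_mul (K := (μ.real Set.univ).toNNReal) fun f g => ?_).continuous
  rw [dist_eq_norm, dist_eq_norm, ← integralOp_sub, Real.coe_toNNReal _ (by positivity), mul_comm]
  exact U.norm_integralOp_le μ _

theorem commute_integralOp [CompleteSpace H] {S : H →L[ℂ] H} (hS : ∀ x, Commute S (U.toFun x))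
    (f : C(G, ℂ)) : Commute S (U.integralOp μ f) := by
  ext v
  simp only [mul_apply_eq_comp, integralOp_apply]
  rw [← ContinuousLinearMap.integral_comp_comm _ (U.integrable_smul μ f v)]
  refine integral_congr_ae (Filter.Eventually.of_forall fun x => ?_)
  simpa using congrArg (f x • ·) (DFunLike.congr_fun (hS x).eq v)

/-- Invariance of `μ` moves the group action onto `f`. Hence `x ↦ U(x) T_f` is norm continuous,
although `U` itself is only strongly continuous. -/
theorem mul_integralOp [IsTopologicalAddGroup G] [CompleteSpace H] [μ.IsAddLeftInvariant] (g : G) (f : C(G, ℂ)) :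
    U.toFun g * U.integralOp μ f = U.integralOp μ (translate f g) := by
  ext v
  simp only [mul_apply_eq_comp, integralOp_apply]
  rw [← ContinuousLinearMap.integral_comp_comm _ (U.integrable_smul μ f v),
    ← integral_add_left_eq_self (fun x => translate f g x • U.toFun x v) g]
  refine integral_congr_ae (Filter.Eventually.of_forall fun x => ?_)
  simp [translate, U.map_add]

theorem eq_zero_of_integralOp_eq_zero [μ.IsOpenPosMeasure] {v : H}
    (h : ∀ f : C(G, ℂ), U.integralOp μ f v = 0) [CompleteSpace H] : v = 0 := by
  have hc : Continuous fun x => inner ℂ v (U.toFun x v) :=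
    continuous_const.inner (U.continuous_apply v)
  -- With this `f`, pairing the integral with `v` gives `∫ |⟨v, U(x)v⟩|²`, whose integrand is
  -- positive at `x = 0` unless `v = 0`.
  let f : C(G, ℂ) := ⟨fun x => star (inner ℂ v (U.toFun x v)), hc.star⟩
  have h1 : ∫ x, inner ℂ v (f x • U.toFun x v) ∂μ = 0 := by
    rw [integral_inner (U.integrable_smul μ f v), ← integralOp_apply, h f, inner_zero_right]
  have h2 : ∀ x, inner ℂ v (f x • U.toFun x v) = ((‖inner ℂ v (U.toFun x v)‖ ^ 2 : ℝ) : ℂ) := by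
    intro x
    rw [inner_smul_right]
    change star (inner ℂ v (U.toFun x v)) * _ = _
    rw [Complex.star_def, Complex.conj_mul', Complex.ofReal_pow]
  simp only [h2] at h1
  rw [integral_complex_ofReal, Complex.ofReal_eq_zero] at h1
  have h3 := (Continuous.integral_pos_of_hasCompactSupport_nonneg_nonzero (μ := μ)
    (f := fun x => ‖inner ℂ v (U.toFun x v)‖ ^ 2) (x := 0) (hc.norm.pow 2)
    (HasCompactSupport.of_compactSpace _) (fun x => by positivity)).mt
  by_contra hv
  refine h3 h1.not_gt ?_
  simp [U.map_zero, hv]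

end UnitaryRep

/-! ### Characters from Gelfand theory -/

section Gelfand

variable {A : Type*} [CommCStarAlgebra A]

theorem exists_characterSpace_apply_ne_zero {a : A} (ha : a ≠ 0) :
    ∃ φ : characterSpace ℂ A, φ a ≠ 0 := by
  by_contra! h
  refine ha ((gelfandTransform_isometry A).injective ?_)
  ext φ
  simpa using h φ

theorem norm_apply_eq_one_of_star_mul_self {a : A} (ha : star a * a = 1)
    (φ : characterSpace ℂ A) : ‖φ a‖ = 1 := by
  have h : φ (star a * a) = 1 := by rw [ha, map_one]
  rw [map_mul, map_star] at h
  have h' : ‖φ a‖ * ‖φ a‖ = 1 := by simpa using congrArg norm h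
  nlinarith [norm_nonneg (φ a)]

end Gelfand

/-- A continuous homomorphism to the unit circle in `ℂ` gives a continuous character. -/
noncomputable def DualGroup.ofCircle {G : Type u} [AddCommGroup G] [TopologicalSpace G]
    (χ : G → Circle) (hc : Continuous χ) (hadd : ∀ x y, χ (x + y) = χ x * χ y) : DualGroup G where
  toFun x := (AddCircle.homeomorphCircle one_ne_zero).symm (χ x)
  map_zero' := by
    have h : χ 0 = 1 := by simpa using hadd 0 0
    rw [h, Homeomorph.symm_apply_eq, AddCircle.homeomorphCircle_apply, AddCircle.toCircle_zero]
  map_add' x y := by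
    rw [hadd, Homeomorph.symm_apply_eq]
    simp only [AddCircle.homeomorphCircle_apply, AddCircle.toCircle_add]
    simp only [← AddCircle.homeomorphCircle_apply one_ne_zero, Homeomorph.apply_symm_apply]
  continuous_toFun := by fun_prop

theorem DualGroup.ofCircle_eq_zero_iff {G : Type u} [AddCommGroup G] [TopologicalSpace G]
    {χ : G → Circle} (hc : Continuous χ) (hadd : ∀ x y, χ (x + y) = χ x * χ y) (g : G) :
    DualGroup.ofCircle χ hc hadd g = 0 ↔ χ g = 1 := by
  change (AddCircle.homeomorphCircle one_ne_zero).symm (χ g) = 0 ↔ _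
  rw [Homeomorph.symm_apply_eq, AddCircle.homeomorphCircle_apply, AddCircle.toCircle_zero]

theorem exists_commutative_starSubalgebra {B : Type*} [CStarAlgebra B] {s : Set B}
    (h : ∀ a ∈ s, ∀ b ∈ s, a * b = b * a) (h' : ∀ a ∈ s, ∀ b ∈ s, a * star b = star b * a) :
    ∃ S : StarSubalgebra ℂ B, s ⊆ S ∧ IsClosed (S : Set B) ∧ ∀ x y : S, x * y = y * x := by
  have hm := StarAlgebra.isMulCommutative_adjoin ℂ h h'
  let S := (StarAlgebra.adjoin ℂ s).topologicalClosure
  let _ : CommRing S := (StarAlgebra.adjoin ℂ s).commRingTopologicalClosure fun x y => mul_comm' x y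
  exact ⟨S, (StarAlgebra.subset_adjoin ℂ s).trans (StarSubalgebra.le_topologicalClosure _),
    StarSubalgebra.isClosed_topologicalClosure _, fun x y => mul_comm x y⟩

/-- The operators `U(x)` and `T_f` lie in a commutative C*-algebra. A point φ of its spectrum not
killing `(U(g) - 1) T_f` gives the character `x ↦ φ(U(x))`, nontrivial at `g`. -/
theorem UnitaryRep.exists_character_apply_ne_zero {G : Type u} {H : Type*} [AddCommGroup G]
    [TopologicalSpace G] [IsTopologicalAddGroup G] [CompactSpace G]
    [NormedAddCommGroup H] [InnerProductSpace ℂ H] [CompleteSpace H]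
    [MeasurableSpace G] [BorelSpace G] (μ : Measure G) [μ.IsAddHaarMeasure]
    (U : UnitaryRep G H) {g : G} (hg : U.toFun g ≠ 1) : ∃ χ : DualGroup G, χ g ≠ 0 := by
  -- Otherwise every `T_f` kills `(U(g) - 1) v` for all `v`, forcing `U(g) = 1`.
  obtain ⟨f, hf⟩ : ∃ f : C(G, ℂ), (U.toFun g - 1) * U.integralOp μ f ≠ 0 := by
    by_contra! h
    refine hg (sub_eq_zero.1 (ContinuousLinearMap.ext fun v => ?_))
    refine U.eq_zero_of_integralOp_eq_zero μ fun f => ?_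
    have hcomm : Commute (U.toFun g - 1) (U.integralOp μ f) :=
      U.commute_integralOp μ (fun x => (U.commute g x).sub_left (Commute.one_left _)) f
    have := DFunLike.congr_fun (hcomm.eq.symm.trans (h f)) v
    simpa using this
  have hUT : ∀ x f, Commute (U.toFun x) (U.integralOp μ f) := fun x f =>
    U.commute_integralOp μ (U.commute x) f
  have hUTs : ∀ x f, Commute (U.toFun x) (star (U.integralOp μ f)) := fun x f => by
    have := (hUT (-x) f).star_star
    rwa [U.star_eq, neg_neg] at this
  obtain ⟨S, hsS, hScl, hS⟩ := exists_commutative_starSubalgebra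
    (s := Set.range U.toFun ∪ Set.range (U.integralOp μ))
    (by
      rintro _ (⟨x, rfl⟩ | ⟨x, rfl⟩) _ (⟨y, rfl⟩ | ⟨y, rfl⟩)
      · exact U.commute x y
      · exact hUT x y
      · exact (hUT y x).symm
      · exact U.commute_integralOp μ (fun z => (hUT z x).symm) y)
    (by
      rintro _ (⟨x, rfl⟩ | ⟨x, rfl⟩) _ (⟨y, rfl⟩ | ⟨y, rfl⟩)
      · rw [U.star_eq]; exact U.commute x _
      · exact hUTs x y
      · rw [U.star_eq]; exact (hUT _ x).symm
      · exact (U.commute_integralOp μ (fun z => (hUTs z y).symm) x).symm)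
  let _ : CommCStarAlgebra S := { StarSubalgebra.cstarAlgebra S with mul_comm := hS }
  let u : G → S := fun x => ⟨U.toFun x, hsS (Or.inl ⟨x, rfl⟩)⟩
  let t : C(G, ℂ) → S := fun f => ⟨U.integralOp μ f, hsS (Or.inr ⟨f, rfl⟩)⟩
  have hu_add : ∀ x y, u (x + y) = u x * u y := fun x y => Subtype.ext (U.map_add x y)
  have hu_star : ∀ x, star (u x) * u x = 1 := fun x => Subtype.ext <| by
    change star (U.toFun x) * U.toFun x = 1
    rw [U.star_eq, (U.commute _ _).eq, U.mul_neg_self]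
  have hut : ∀ x, u x * t f = t (UnitaryRep.translate f x) := fun x =>
    Subtype.ext (U.mul_integralOp μ x f)
  have ht : Continuous t := (U.continuous_integralOp μ).subtype_mk _
  have hne : (u g - 1) * t f ≠ 0 := fun h => hf (congrArg Subtype.val h)
  obtain ⟨φ, hφ⟩ := exists_characterSpace_apply_ne_zero hne
  rw [map_mul, map_sub, map_one, mul_ne_zero_iff, sub_ne_zero] at hφ
  have hcont : Continuous fun x => φ (u x) := by
    -- Dividing by `φ(T_f) ≠ 0` reduces continuity to that of `x ↦ T_{f(· - x)}` in norm.
    have h1 : (fun x => φ (u x)) = fun x => φ (t (UnitaryRep.translate f x)) / φ (t f) := by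
      funext x
      rw [← hut, map_mul, mul_div_cancel_right₀ _ hφ.2]
    rw [h1]
    have h2 : Continuous φ := map_continuous φ
    exact (h2.comp (ht.comp (UnitaryRep.continuous_translate f))).div_const _
  have hnorm : ∀ x, φ (u x) ∈ Submonoid.unitSphere ℂ := fun x => by
    simpa [Submonoid.unitSphere] using norm_apply_eq_one_of_star_mul_self (hu_star x) φ
  refine ⟨DualGroup.ofCircle (fun x => (⟨φ (u x), hnorm x⟩ : Circle)) (hcont.subtype_mk _)
    (fun x y => Subtype.ext ?_), ?_⟩
  · change φ (u (x + y)) = φ (u x) * φ (u y)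
    rw [hu_add, map_mul]
  · exact fun h => hφ.1 (congrArg Subtype.val ((DualGroup.ofCircle_eq_zero_iff _ _ _).1 h))

/-! ### Characters separate points -/

/-- The regular representation of a compact abelian group on `L²`. -/
noncomputable def regularRep {G : Type u} [AddCommGroup G] [TopologicalSpace G]
    [IsTopologicalAddGroup G] [CompactSpace G] [MeasurableSpace G] [BorelSpace G] (μ : Measure G)
    [μ.IsAddLeftInvariant] [μ.Regular] : UnitaryRep G (Lp ℂ 2 μ) where
  toFun x := LinearMap.mkContinuous
    { toFun := fun v => DomAddAct.mk x +ᵥ v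
      map_add' := fun v w => DomAddAct.vadd_Lp_add _ v w
      map_smul' := fun c v => by rcases v with ⟨⟨_⟩, _⟩; rfl } 1
    fun v => by simp
  map_zero := by
    ext1 v
    exact zero_vadd Gᵈᵃᵃ v
  map_add x y := by
    ext1 v
    change DomAddAct.mk (x + y) +ᵥ v = DomAddAct.mk x +ᵥ (DomAddAct.mk y +ᵥ v)
    rw [← add_vadd, add_comm x y]; rfl
  norm_map x v := DomAddAct.norm_vadd_Lp _ v
  continuous_apply v :=
    have : Fact ((2 : ENNReal) ≠ ⊤) := ⟨ENNReal.ofNat_ne_top⟩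
    (continuous_id.vadd continuous_const : Continuous fun y : Gᵈᵃᵃ => y +ᵥ v).comp
      DomAddAct.continuous_mk

theorem exists_dualGroup_apply_ne_zero {G : Type u} [AddCommGroup G] [TopologicalSpace G]
    [IsTopologicalAddGroup G] [CompactSpace G] [T2Space G] {g : G} (hg : g ≠ 0) :
    ∃ χ : DualGroup G, χ g ≠ 0 := by
  borelize G
  let μ : Measure G := Measure.addHaar
  refine (regularRep μ).exists_character_apply_ne_zero μ fun h => ?_
  -- Urysohn function that translation by `g` changes; Haar measure charges open sets, so a.e.
  -- equality of continuous functions is equality.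
  obtain ⟨f, hf0, hf1, -⟩ := exists_continuous_zero_one_of_isClosed
    (isClosed_singleton (x := (0 : G))) (isClosed_singleton (x := g))
    (by simpa using hg.symm)
  let F : C(G, ℂ) := ⟨fun x => (f x : ℂ), by fun_prop⟩
  have hF : MemLp F 2 μ := F.continuous.memLp_of_hasCompactSupport (HasCompactSupport.of_compactSpace _)
  have h1 : DomAddAct.mk g +ᵥ hF.toLp F = hF.toLp F := DFunLike.congr_fun h _
  rw [DomAddAct.mk_vadd_toLp, MemLp.toLp_eq_toLp_iff] at h1
  have h2 := (Continuous.ae_eq_iff_eq μ (by fun_prop) F.continuous).1 h1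
  have h3 : F (g + 0) = F 0 := congrFun h2 0
  have h4 : f g = 1 := hf1 rfl
  have h5 : f 0 = 0 := hf0 rfl
  simp [F, h4, h5] at h3

/-- If the dual had finite order `n`, all characters would take values in the finite `n`-torsion of
the circle, and by separation of points `G` would embed in a finite power of it. -/
theorem infinite_dualGroup (G : Type u) [AddCommGroup G] [TopologicalSpace G]
    [IsTopologicalAddGroup G] [CompactSpace G] [T2Space G] [Infinite G] :
    Infinite (DualGroup G) := by
  by_contra h
  have : Finite (DualGroup G) := not_infinite_iff_finite.1 h
  let n := Nat.card (DualGroup G)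
  have hfin : Finite {t : CircleGroup | n • t = 0} :=
    AddCircle.finite_torsion 1 Nat.card_pos
  have hmem : ∀ (χ : DualGroup G) (g : G), χ g ∈ {t : CircleGroup | n • t = 0} := fun χ g => by
    have h : n • χ = 0 := card_nsmul_eq_zero'
    let ev : DualGroup G →+ CircleGroup :=
      { toFun := fun χ => χ g, map_zero' := rfl, map_add' := fun _ _ => rfl }
    exact (map_nsmul ev n χ).symm.trans ((congrArg ev h).trans (map_zero ev))
  refine not_finite_iff_infinite.2 ‹Infinite G› (Finite.of_injective
    (fun g (χ : DualGroup G) => (⟨χ g, hmem χ g⟩ : {t : CircleGroup | n • t = 0})) ?_)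
  intro x y hxy
  by_contra hne
  obtain ⟨χ, hχ⟩ := exists_dualGroup_apply_ne_zero (sub_ne_zero.2 hne)
  refine hχ ?_
  rw [map_sub, sub_eq_zero]
  exact congrArg Subtype.val (congrFun hxy χ)

/-! ### Weight and the size of the dual -/

theorem topWeight_le_mk {Y : Type u} [TopologicalSpace Y] {B : Set (Set Y)}
    (hB : TopologicalSpace.IsTopologicalBasis B) : topWeight Y ≤ #B :=
  csInf_le' ⟨B, hB, rfl⟩

theorem exists_basis_mk_eq_topWeight (Y : Type u) [TopologicalSpace Y] :
    ∃ B : Set (Set Y), TopologicalSpace.IsTopologicalBasis B ∧ #B = topWeight Y := by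
  have hne : {c | ∃ B : Set (Set Y), TopologicalSpace.IsTopologicalBasis B ∧ #B = c}.Nonempty :=
    ⟨_, _, TopologicalSpace.isTopologicalBasis_opens, rfl⟩
  exact csInf_mem hne

/-- Preimages of basic sets under the coordinates form a subbase indexed by `ι × B` with `B`
countable, and finite intersections do not raise an infinite cardinal. -/
theorem topWeight_le_of_isInducing {Y ι : Type u} {Z : Type} [TopologicalSpace Y]
    [TopologicalSpace Z] [SecondCountableTopology Z] [Infinite ι] {f : Y → ι → Z}
    (hf : Topology.IsInducing f) : topWeight Y ≤ #ι := by
  let B := TopologicalSpace.countableBasis Z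
  let e : ι × B → Set Y := fun p => (fun y => f y p.1) ⁻¹' p.2
  have hgen : ‹TopologicalSpace Y› = TopologicalSpace.generateFrom (Set.range e) := by
    have hBas := TopologicalSpace.isBasis_countableBasis Z
    refine le_antisymm (le_generateFrom ?_) ?_
    · rintro _ ⟨p, rfl⟩
      exact (hBas.isOpen p.2.2).preimage ((continuous_apply p.1).comp hf.continuous)
    · rw [hf.eq_induced, Pi.topologicalSpace, induced_iInf]
      refine le_iInf fun i => ?_
      rw [induced_compose, hBas.eq_generateFrom, induced_generateFrom_eq]
      refine le_generateFrom ?_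
      rintro _ ⟨b, hb, rfl⟩
      exact TopologicalSpace.isOpen_generateFrom_of_mem ⟨(i, ⟨b, hb⟩), rfl⟩
  have hbasis := TopologicalSpace.isTopologicalBasis_of_subbasis hgen
  refine (topWeight_le_mk hbasis).trans ?_
  have hsub : ((fun c => ⋂₀ c) '' {c : Set (Set Y) | c.Finite ∧ c ⊆ Set.range e}) ⊆
      Set.range fun t : Finset (ι × B) => ⋂₀ (e '' t) := by
    rintro _ ⟨c, ⟨hc, hce⟩, rfl⟩
    choose r hr using hce
    have := hc.to_subtype
    refine ⟨(Set.finite_range fun b : c => r b.2).toFinset, congrArg _ ?_⟩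
    rw [Set.Finite.coe_toFinset, ← Set.range_comp]
    exact (congrArg Set.range (funext fun b : c => hr b.2)).trans Subtype.range_coe
  have hB : #B ≤ ℵ₀ := le_aleph0_iff_set_countable.2 (TopologicalSpace.countable_countableBasis Z)
  -- If `B` is empty, `ι × B` is not infinite and `mk_finset_of_infinite` does not apply.
  rcases isEmpty_or_nonempty B with hBe | hBn
  · have : Fintype (Finset (ι × B)) := Fintype.ofFinite _
    exact (mk_le_mk_of_subset hsub).trans <| mk_range_le.trans <|
      (lt_aleph0_of_finite _).le.trans (aleph0_le_mk ι)
  · refine (mk_le_mk_of_subset hsub).trans (mk_range_le.trans ?_)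
    rw [mk_finset_of_infinite, mk_prod, lift_uzero]
    exact mul_le_of_le (aleph0_le_mk ι) le_rfl ((lift_le_aleph0.2 hB).trans (aleph0_le_mk ι))

/-- Evaluation embeds the compact group `G` into the power of the circle indexed by its dual. -/
theorem topWeight_le_mk_dualGroup (G : Type u) [AddCommGroup G] [TopologicalSpace G]
    [IsTopologicalAddGroup G] [CompactSpace G] [T2Space G] [Infinite G] :
    topWeight G ≤ #(DualGroup G) := by
  have := infinite_dualGroup G
  refine topWeight_le_of_isInducing (f := fun (g : G) (χ : DualGroup G) => χ g) ?_
  refine Topology.IsClosedEmbedding.isInducing (Continuous.isClosedEmbedding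
    (continuous_pi fun χ => map_continuous χ) fun x y hxy => ?_)
  by_contra hne
  obtain ⟨χ, hχ⟩ := exists_dualGroup_apply_ne_zero (sub_ne_zero.2 hne)
  exact hχ (by rw [map_sub, sub_eq_zero]; exact congrFun hxy χ)

/-! ### Finite records and counting -/

theorem exists_finite_open_cover_sub_mem {T : Type*} [AddCommGroup T] [TopologicalSpace T]
    [IsTopologicalAddGroup T] [CompactSpace T] {U : Set T} (hU : U ∈ nhds 0) :
    ∃ (t : Finset T) (D : T → Set T), (∀ c, IsOpen (D c)) ∧ (∀ x, ∃ c ∈ t, x ∈ D c) ∧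
      ∀ c, ∀ x ∈ D c, ∀ y ∈ D c, x - y ∈ U := by
  have h : ∀ c : T, ∃ V : Set T, IsOpen V ∧ c ∈ V ∧ ∀ x ∈ V, ∀ y ∈ V, x - y ∈ U := by
    intro c
    have hc : Filter.Tendsto (fun p : T × T => p.1 - p.2) (nhds (c, c)) (nhds 0) := by
      have := (continuous_sub (G := T)).tendsto (c, c)
      rwa [sub_self] at this
    have := hc hU
    rw [nhds_prod_eq, Filter.mem_map, Filter.mem_prod_self_iff] at this
    obtain ⟨V, hV, hVU⟩ := this
    obtain ⟨W, hWV, hW, hcW⟩ := mem_nhds_iff.1 hV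
    exact ⟨W, hW, hcW, fun x hx y hy => hVU (Set.mk_mem_prod (hWV hx) (hWV hy))⟩
  choose D hD hcD hDU using h
  obtain ⟨t, ht⟩ := isCompact_univ.elim_finite_subcover D hD fun c _ => Set.mem_iUnion.2 ⟨c, hcD c⟩
  exact ⟨t, D, hD, fun x => by simpa using ht (Set.mem_univ x), hDU⟩

theorem exists_finset_subordinate_cover {Y T : Type*} [TopologicalSpace Y] [CompactSpace Y]
    [TopologicalSpace T] {B : Set (Set Y)} (hB : TopologicalSpace.IsTopologicalBasis B)
    {t : Finset T} {D : T → Set T} (hD : ∀ c, IsOpen (D c)) (ht : ∀ x, ∃ c ∈ t, x ∈ D c)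
    {f : Y → T} (hf : Continuous f) :
    ∃ s : Finset (B × t), (∀ p ∈ s, Set.MapsTo f p.1 (D p.2)) ∧ ∀ y, ∃ p ∈ s, y ∈ (p.1 : Set Y) := by
  have h : ∀ y, ∃ p : B × t, y ∈ (p.1 : Set Y) ∧ Set.MapsTo f p.1 (D p.2) := by
    intro y
    obtain ⟨c, hct, hc⟩ := ht (f y)
    obtain ⟨b, hb, hyb, hbD⟩ := hB.exists_subset_of_mem_open hc ((hD c).preimage hf)
    exact ⟨(⟨b, hb⟩, ⟨c, hct⟩), hyb, hbD⟩
  choose p hp hpD using h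
  classical
  obtain ⟨I, hI⟩ := isCompact_univ.elim_finite_subcover (fun y => ((p y).1 : Set Y))
    (fun y => hB.isOpen (p y).1.2) fun y _ => Set.mem_iUnion.2 ⟨y, hp y⟩
  refine ⟨I.image p, ?_, fun y => ?_⟩
  · simpa using fun y _ => hpD y
  · simpa using hI (Set.mem_univ y)

theorem Cardinal.mk_finset_lt {α : Type*} {c : Cardinal} (hc : ℵ₀ ≤ c) (h : #α < c) :
    #(Finset α) < c := by
  rcases finite_or_infinite α with hα | hα
  · exact (lt_aleph0_of_finite _).trans_le hc
  · rwa [mk_finset_of_infinite]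

/-- Subtracting a chosen representative of its fibre sends `a` into `W`, so `A` injects into `F ×
W`; both factors being smaller than the infinite `A` is impossible. -/
theorem mk_eq_of_fibers_sub_mem {A F : Type u} [AddCommGroup A] [Infinite A] {W : Set A}
    (s : A → F) (hF : #F < #A) (hs : ∀ a b, s a = s b → a - b ∈ W) : #W = #A := by
  refine (mk_set_le W).antisymm (le_of_not_gt fun hW => ?_)
  choose r hr using fun y : Set.range s => y.2
  have hinj : Function.Injective fun a : A =>
      ((s a, ⟨a - r ⟨s a, a, rfl⟩, hs _ _ (hr ⟨s a, a, rfl⟩).symm⟩) : F × W) := by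
    intro a b hab
    rw [Prod.mk.injEq] at hab
    obtain ⟨h1, h2⟩ := hab
    have h2 := congrArg Subtype.val h2
    simpa only [h1, sub_left_inj] using h2
  have h := mk_le_of_injective hinj
  rw [mk_prod, lift_id, lift_id] at h
  exact h.not_gt (mul_lt_of_lt (aleph0_le_mk A) hF hW)

theorem mainTheorem2 (G : Type u) [AddCommGroup G] [TopologicalSpace G] [IsTopologicalAddGroup G]
    [CompactSpace G] [T2Space G] [Infinite G]
    (X : Set G) (hX : IsClosed X) (hw : topWeight X < topWeight G)
    (U : Set CircleGroup) (hU : IsOpen U) (h0 : (0 : CircleGroup) ∈ U) :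
    Cardinal.mk (charSet X U) = Cardinal.mk (DualGroup G) := by
  have := infinite_dualGroup G
  have : CompactSpace X := isCompact_iff_compactSpace.1 hX.isCompact
  obtain ⟨B, hB, hBX⟩ := exists_basis_mk_eq_topWeight X
  have hBlt : #B < #(DualGroup G) := hBX ▸ hw.trans_le (topWeight_le_mk_dualGroup G)
  obtain ⟨t, D, hD, ht, hDU⟩ := exists_finite_open_cover_sub_mem (hU.mem_nhds h0)
  choose s hs hcov using fun χ : DualGroup G => exists_finset_subordinate_cover hB hD ht
    (f := fun x : X => χ x) ((map_continuous χ).comp continuous_subtype_val)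
  refine mk_eq_of_fibers_sub_mem s (mk_finset_lt (aleph0_le_mk _) ?_) ?_
  · rw [mk_prod, lift_uzero]
    exact mul_lt_of_lt (aleph0_le_mk _) hBlt
      ((lift_lt_aleph0.2 (lt_aleph0_of_finite _)).trans_le (aleph0_le_mk _))
  · rintro χ ψ h _ ⟨x, hx, rfl⟩
    -- A shared record puts `χ x` and `ψ x` in the same `D c`, so their difference lies in `U`.
    obtain ⟨p, hp, hxp⟩ := hcov χ ⟨x, hx⟩
    exact hDU p.2 _ (hs χ p hp hxp) _ (hs ψ p (h ▸ hp) hxp)
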